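/- For integers $n\ge 2$ and $1\le i<j\le n$, consider the hyperplanes of $\mathbb{R}^n$ $$C_{ij}=\{x\mid x_i=x_j\},\qquad S_{ij}=\{x\mid x_i=x_j+1\},\qquad I_{ij}=\{x\mid x_1=x_j+i\}.$$ Let $\mathrm{Shi}_n=\{C_{ij},S_{ij}\mid 1\le i<j\le n\}$ and $\mathrm{Ish}_n=\{C_{ij},I_{ij}\mid 1\le i<j\le n\}$ be the Shi and the Ish arrangement. For $1\le k<n$ let $\mathcal{A}^{(k,n)}$ be the arrangement formed by all $C_{ij}$ with $1\le i<j\le n$, all $S_{ij}$ with $k<i<j\le n$, and all $I_{ij}$ with $1\le i\le k$ and $i<j\le n$. The characteristic polynomial of a finite arrangement $\mathcal{A}$ of affine hyperplanes in $\mathbb{R}^n$ is $$\chi(\mathcal{A},q)=\sum_{F\in L(\mathcal{A})}\mu(\mathbb{R}^n,F)\,q^{\dim F},$$ where $L(\mathcal{A})$ is the set of nonempty intersections of subfamilies of $\mathcal{A}$ (including $\mathbb{R}^n$, the empty intersection), ordered by reverse inclusion, and $\mu$ is its Möbius function. **Theorem.** For all integers $1\le k<n$, $$\chi(\mathcal{A}^{(k,n)},q)=q(q-n)^{n-1}.$$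 In particular this polynomial does not depend on $k$, and $\chi(\mathcal{A}^{(k,n)},q)=\chi(\mathrm{Shi}_n,q)=\chi(\mathrm{Ish}_n,q)$. -/

import Mathlib

noncomputable section

namespace HyperplaneArrangement

open scoped Classical in
/-- The flats of a finite arrangement `A` of affine hyperplanes in `V`: the nonempty intersections
of subfamilies of `A`. The empty subfamily gives the whole space. -/
def flats {V : Type*} [AddCommGroup V] [Module ℝ V] (A : Finset (AffineSubspace ℝ V)) :
    Finset (AffineSubspace ℝ V) :=
  (A.powerset.image fun B : Finset (AffineSubspace ℝ V) =>
      sInf (B : Set (AffineSubspace ℝ V))).filter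
    fun F => (F : Set V).Nonempty

theorem top_mem_flats {V : Type*} [AddCommGroup V] [Module ℝ V]
    (A : Finset (AffineSubspace ℝ V)) : (⊤ : AffineSubspace ℝ V) ∈ flats A := by
  classical
  simp only [flats, Finset.mem_filter, Finset.mem_image]
  exact ⟨⟨∅, by simp, by simp⟩, ⟨0, by simp⟩⟩

/-- The intersection poset `L(A)`: the flats of `A`, ordered by reverse inclusion. -/
abbrev IntersectionPoset {V : Type*} [AddCommGroup V] [Module ℝ V]
    (A : Finset (AffineSubspace ℝ V)) : Type _ :=
  {F : AffineSubspace ℝ V // F ∈ flats A}ᵒᵈ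

/-- The minimum of `L(A)`, which is the whole space. -/
def bottom {V : Type*} [AddCommGroup V] [Module ℝ V] (A : Finset (AffineSubspace ℝ V)) :
    IntersectionPoset A :=
  OrderDual.toDual ⟨⊤, top_mem_flats A⟩

open scoped Classical in
instance instLocallyFiniteOrder {V : Type*} [AddCommGroup V] [Module ℝ V] (A : Finset (AffineSubspace ℝ V)) :
    LocallyFiniteOrder (IntersectionPoset A) :=
  Fintype.toLocallyFiniteOrder

open scoped Classical in
/-- The characteristic polynomial `χ(A, q) = ∑_{F ∈ L(A)} μ(0̂, F) q ^ dim F`, where `μ` is the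
Möbius function of `L(A)` and `0̂` is its minimum. -/
def charPoly {V : Type*} [AddCommGroup V] [Module ℝ V] (A : Finset (AffineSubspace ℝ V)) :
    Polynomial ℤ :=
  ∑ F : IntersectionPoset A,
    Polynomial.C (IncidenceAlgebra.mu ℤ (bottom A) F) *
      Polynomial.X ^ Module.finrank ℝ (OrderDual.ofDual F).1.direction

/-- The affine subspace `x_i = x_j + c` of `ℝⁿ`; it is a hyperplane when `i ≠ j`. -/
def differenceHyperplane {n : ℕ} (i j : Fin n) (c : ℝ) : AffineSubspace ℝ (Fin n → ℝ) where
  carrier := {x | x i = x j + c}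
  smul_vsub_vadd_mem' := by
    intro t p q r hp hq hr
    simp only [Set.mem_ofPred_eq, vsub_eq_sub, vadd_eq_add, Pi.add_apply, Pi.smul_apply,
      Pi.sub_apply, smul_eq_mul] at *
    rw [hp, hq, hr]
    ring

/-! The index `i ∈ {1, …, n}` is represented by the element of `Fin n` with value `i - 1`,
so the label of `i : Fin n` is `(i : ℕ) + 1`, and the coordinate `x_1` has index `0`. -/

/-- `C_{ij}`: `x_i = x_j`. -/
def coxHyperplane {n : ℕ} (i j : Fin n) : AffineSubspace ℝ (Fin n → ℝ) :=
  differenceHyperplane i j 0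

/-- `S_{ij}`: `x_i = x_j + 1`. -/
def shiHyperplane {n : ℕ} (i j : Fin n) : AffineSubspace ℝ (Fin n → ℝ) :=
  differenceHyperplane i j 1

/-- `I_{ij}`: `x_1 = x_j + i`. -/
def ishHyperplane {n : ℕ} (i j : Fin n) : AffineSubspace ℝ (Fin n → ℝ) :=
  differenceHyperplane ⟨0, i.pos⟩ j (((i : ℕ) + 1 : ℕ) : ℝ)

/-- The pairs `(i, j)` with `i < j`. -/
def pairs (n : ℕ) : Finset (Fin n × Fin n) :=
  Finset.univ.filter fun p => p.1 < p.2

open scoped Classical in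
/-- The Coxeter arrangement `Cox_n`. -/
def cox (n : ℕ) : Finset (AffineSubspace ℝ (Fin n → ℝ)) :=
  (pairs n).image fun p => coxHyperplane p.1 p.2

open scoped Classical in
/-- The Shi arrangement `Shi_n`. -/
def shi (n : ℕ) : Finset (AffineSubspace ℝ (Fin n → ℝ)) :=
  cox n ∪ (pairs n).image fun p => shiHyperplane p.1 p.2

open scoped Classical in
/-- The Ish arrangement `Ish_n`. -/
def ish (n : ℕ) : Finset (AffineSubspace ℝ (Fin n → ℝ)) :=
  cox n ∪ (pairs n).image fun p => ishHyperplane p.1 p.2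

open scoped Classical in
/-- The arrangement `A^X`, for a set `X` of labels in `{1, …, n}`: the hyperplanes `C_{ij}` for all
`i < j`, `S_{ij}` for `i < j` with `i ∈ X`, and `I_{ij}` for `i < j` with `i ∉ X`. -/
def between (n : ℕ) (X : Finset ℕ) : Finset (AffineSubspace ℝ (Fin n → ℝ)) :=
  cox n ∪
    ((pairs n).filter fun p => (p.1 : ℕ) + 1 ∈ X).image (fun p => shiHyperplane p.1 p.2) ∪
    ((pairs n).filter fun p => (p.1 : ℕ) + 1 ∉ X).image (fun p => ishHyperplane p.1 p.2)

end HyperplaneArrangement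

end

/-!
By Whitney's formula `χ(A, q)` is the sum over subfamilies `S` with nonempty intersection of
`(-1)^|S| q^dim`. The hyperplanes here have equations `x_i = x_j + c` with `c` an integer, and for
large `m` a system of such equations is solvable modulo `m` only if it is solvable over `ℤ`, in
which case it has `m^dim` solutions modulo `m`. By inclusion-exclusion, `χ(A, m)` therefore counts
the points of `(ℤ/m)ⁿ` that satisfy none of the equations.

To count these points, fix `x_1` in one of `m` ways and place each `j ≥ 2` in the cell `x_1 - x_j`
of a row. The forbidden equations keep the labels off the first cells and forbid some adjacent
pairs. The smallest label can always be inserted last. If it comes from an Ish index, then every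
other label avoids the first cell, and dropping that cell leaves a smaller placement, into which
the label returns at any free cell. If it comes from a Shi index, then the next cell is empty, and
deleting the cell of the label leaves a smaller placement, with the label again recorded by a free
cell. Each insertion thus has the same number of choices, which gives `m (m - n)^(n - 1)` for
every `k`.
-/

namespace HyperplaneArrangement

section Whitney

variable {V ι : Type*} [AddCommGroup V] [Module ℝ V]

instance instOrderBot (A : Finset (AffineSubspace ℝ V)) : OrderBot (IntersectionPoset A) where
  bot := bottom A
  bot_le _ := show _ ≤ (⊤ : AffineSubspace ℝ V) from le_top

theorem mem_inf_iff {h : ι → AffineSubspace ℝ V} {S : Finset ι} {x : V} :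
    x ∈ S.inf h ↔ ∀ e ∈ S, x ∈ h e := by
  simp [Finset.inf_eq_sInf_image, AffineSubspace.mem_sInf_iff]

open scoped Classical in
theorem mem_flats_image_iff {h : ι → AffineSubspace ℝ V} {E : Finset ι} {F : AffineSubspace ℝ V} :
    F ∈ flats (E.image h) ↔ (∃ S ⊆ E, S.inf h = F) ∧ (F : Set V).Nonempty := by
  simp only [flats, Finset.mem_filter, Finset.mem_image, Finset.mem_powerset,
    Finset.subset_image_iff, Finset.inf_eq_sInf_image, exists_exists_and_eq_and, Finset.coe_image]

open scoped Classical in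
theorem inf_mem_flats_image_iff {h : ι → AffineSubspace ℝ V} {E S : Finset ι} (hS : S ⊆ E) :
    S.inf h ∈ flats (E.image h) ↔ ((S.inf h : AffineSubspace ℝ V) : Set V).Nonempty :=
  mem_flats_image_iff.trans (and_iff_right ⟨S, hS, rfl⟩)

open scoped Classical in
/-- The sum of `(-1) ^ |S|` over the subfamilies `S` of `h` on `E` with intersection `F`. Unlike a
sum over subsets of `E.image h`, it allows `h` to repeat a hyperplane. -/
noncomputable def signedCount (h : ι → AffineSubspace ℝ V) (E : Finset ι)
    (F : AffineSubspace ℝ V) : ℤ :=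
  ∑ S ∈ E.powerset with S.inf h = F, (-1) ^ S.card

open scoped Classical in
theorem sum_signedCount_smul {M : Type*} [AddCommGroup M] (h : ι → AffineSubspace ℝ V)
    (E : Finset ι) (φ : AffineSubspace ℝ V → M) :
    ∑ G : IntersectionPoset (E.image h), signedCount h E (OrderDual.ofDual G).1 •
        φ (OrderDual.ofDual G).1 =
      ∑ S ∈ E.powerset with ((S.inf h : AffineSubspace ℝ V) : Set V).Nonempty,
        (-1 : ℤ) ^ S.card • φ (S.inf h) := by
  calc ∑ G : IntersectionPoset (E.image h), signedCount h E (OrderDual.ofDual G).1 •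
          φ (OrderDual.ofDual G).1
    _ = ∑ F ∈ flats (E.image h), signedCount h E F • φ F :=
      Finset.sum_coe_sort (flats (E.image h)) fun F => signedCount h E F • φ F
    _ = ∑ F ∈ flats (E.image h), ∑ S ∈ E.powerset with S.inf h = F,
          (-1 : ℤ) ^ S.card • φ (S.inf h) := by
      refine Finset.sum_congr rfl fun F _ => ?_
      rw [signedCount, Finset.sum_smul]
      exact Finset.sum_congr rfl fun S hS => by rw [(Finset.mem_filter.1 hS).2]
    _ = _ := by
      rw [Finset.sum_fiberwise_eq_sum_filter E.powerset (flats (E.image h)) (·.inf h)]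
      exact congrArg (Finset.sum · _) (Finset.filter_congr fun S hS =>
        inf_mem_flats_image_iff (Finset.mem_powerset.1 hS))

open scoped Classical in
theorem forall_not_le_iff_eq_bot {h : ι → AffineSubspace ℝ V} {E : Finset ι}
    (htop : ∀ e ∈ E, h e ≠ ⊤) (F : IntersectionPoset (E.image h)) :
    (∀ e ∈ E, ¬ (OrderDual.ofDual F).1 ≤ h e) ↔ F = ⊥ := by
  constructor
  · intro hF
    obtain ⟨⟨S, hS, hSF⟩, -⟩ := mem_flats_image_iff.1 (OrderDual.ofDual F).2
    have hS_empty : S = ∅ := Finset.eq_empty_of_forall_notMem fun e he =>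
      hF e (hS he) (hSF ▸ Finset.inf_le he)
    exact OrderDual.ofDual.injective (Subtype.ext (by rw [← hSF, hS_empty]; rfl))
  · rintro rfl e he hle
    exact htop e he (top_le_iff.1 hle)

open scoped Classical in
theorem sum_signedCount_Iic {h : ι → AffineSubspace ℝ V} {E : Finset ι} (htop : ∀ e ∈ E, h e ≠ ⊤)
    (F : IntersectionPoset (E.image h)) :
    ∑ G ∈ Finset.Iic F, signedCount h E (OrderDual.ofDual G).1 = if F = ⊥ then 1 else 0 := by
  have hne := (mem_flats_image_iff.1 (OrderDual.ofDual F).2).2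
  let indicator (G : AffineSubspace ℝ V) : ℤ := if (OrderDual.ofDual F).1 ≤ G then 1 else 0
  have hsubsets : {S ∈ E.powerset | ((S.inf h : AffineSubspace ℝ V) : Set V).Nonempty ∧
      (OrderDual.ofDual F).1 ≤ S.inf h} = {e ∈ E | (OrderDual.ofDual F).1 ≤ h e}.powerset := by
    ext S
    simp only [Finset.mem_filter, Finset.mem_powerset, Finset.le_inf_iff, Finset.subset_iff]
    exact ⟨fun H e he => ⟨H.1 he, H.2.2 e he⟩, fun H =>
      ⟨fun e he => (H he).1, hne.mono (Finset.le_inf fun e he => (H he).2), fun e he => (H he).2⟩⟩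
  calc ∑ G ∈ Finset.Iic F, signedCount h E (OrderDual.ofDual G).1
    _ = ∑ G : IntersectionPoset (E.image h), signedCount h E (OrderDual.ofDual G).1 •
          indicator (OrderDual.ofDual G).1 := by
      simp only [indicator, smul_eq_mul, mul_ite, mul_one, mul_zero, ← Finset.sum_filter]
      exact congrArg (Finset.sum · _) (by ext G; simp)
    _ = ∑ S ∈ {e ∈ E | (OrderDual.ofDual F).1 ≤ h e}.powerset, (-1) ^ S.card := by
      rw [sum_signedCount_smul h E indicator, ← hsubsets]
      simp only [indicator, smul_eq_mul, mul_ite, mul_one, mul_zero, ← Finset.sum_filter,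
        Finset.filter_filter]
    _ = if F = ⊥ then 1 else 0 := by
      rw [Finset.sum_powerset_neg_one_pow_card]
      exact if_congr (Finset.filter_eq_empty_iff.trans (forall_not_le_iff_eq_bot htop F)) rfl rfl

open scoped Classical in
theorem mu_bottom_eq_signedCount {h : ι → AffineSubspace ℝ V} {E : Finset ι}
    (htop : ∀ e ∈ E, h e ≠ ⊤) (F : IntersectionPoset (E.image h)) :
    IncidenceAlgebra.mu ℤ (bottom (E.image h)) F = signedCount h E (OrderDual.ofDual F).1 := by
  have hinversion := IncidenceAlgebra.moebius_inversion_bot (𝕜 := ℤ) _ _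
    (fun G => (sum_signedCount_Iic htop G).symm) F
  change IncidenceAlgebra.mu ℤ ⊥ F = _
  simpa using hinversion.symm

open scoped Classical in
theorem charPoly_image_eq_sum_powerset {h : ι → AffineSubspace ℝ V} {E : Finset ι}
    (htop : ∀ e ∈ E, h e ≠ ⊤) :
    charPoly (E.image h) =
      ∑ S ∈ E.powerset with ((S.inf h : AffineSubspace ℝ V) : Set V).Nonempty,
        (-1 : ℤ) ^ S.card •
          (Polynomial.X : Polynomial ℤ) ^ Module.finrank ℝ (S.inf h).direction := by
  simp only [charPoly, mu_bottom_eq_signedCount htop, ← Polynomial.smul_eq_C_mul]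
  exact sum_signedCount_smul h E fun F => Polynomial.X ^ Module.finrank ℝ F.direction

end Whitney

section DifferenceEquation

variable {ι : Type*}

/-- The triple `(i, j, c)` stands for the equation `x_i = x_j + c` in the coordinates indexed by
`ι`. The constant is an integer so that the equation can be read in every ring. -/
abbrev DifferenceEquation (ι : Type*) : Type _ := ι × ι × ℤ

/-- The vector `x` is a solution of the difference equation `e`. -/
def Satisfies {R : Type*} [Ring R] (x : ι → R) (e : DifferenceEquation ι) : Prop :=
  x e.1 = x e.2.1 + (e.2.2 : R)

/-- The edges of the graph of a system of difference equations: `i` and `j` are linked when some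
equation of the system compares them. Its connected components form the type `Quot (Linked S)`. -/
def Linked (S : Finset (DifferenceEquation ι)) (i j : ι) : Prop :=
  ∃ c, (i, j, c) ∈ S

section Solutions

variable {S : Finset (DifferenceEquation ι)} {R : Type*} [Ring R] {p : ι → ℤ}

theorem Satisfies.intCast {e : DifferenceEquation ι} (hp : Satisfies p e) :
    Satisfies (fun i => (p i : R)) e := by
  simpa [Satisfies] using congrArg (Int.cast : ℤ → R) hp

theorem forall_satisfies_iff_exists_quot (hp : ∀ e ∈ S, Satisfies p e) {x : ι → R} :
    (∀ e ∈ S, Satisfies x e) ↔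
      ∃ y : Quot (Linked S) → R, (fun i => y (Quot.mk _ i) + p i) = x := by
  constructor
  · intro hx
    refine ⟨Quot.lift (fun i => x i - p i) ?_, by simp⟩
    rintro i j ⟨c, hc⟩
    have hxc : x i = x j + c := hx _ hc
    have hpc : (p i : R) = p j + c := (hp _ hc).intCast
    rw [hxc, hpc]
    abel
  · rintro ⟨y, rfl⟩ ⟨i, j, c⟩ he
    have hpc : (p i : R) = p j + c := (hp _ he).intCast
    simp only [Satisfies, hpc, Quot.sound (show Linked S i j from ⟨c, he⟩), add_assoc]

theorem card_solutions [Finite ι] (hp : ∀ e ∈ S, Satisfies p e) :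
    Nat.card {x : ι → R // ∀ e ∈ S, Satisfies x e} = Nat.card R ^ Nat.card (Quot (Linked S)) := by
  rw [← Nat.card_fun]
  symm
  refine Nat.card_eq_of_bijective
    (fun y => ⟨_, (forall_satisfies_iff_exists_quot hp).2 ⟨y, rfl⟩⟩) ⟨?_, ?_⟩
  · intro y z hyz
    funext a
    obtain ⟨i, rfl⟩ := Quot.exists_rep a
    exact add_right_cancel (congrFun (congrArg Subtype.val hyz) i)
  · rintro ⟨x, hx⟩
    obtain ⟨y, rfl⟩ := (forall_satisfies_iff_exists_quot hp).1 hx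
    exact ⟨y, rfl⟩

end Solutions

theorem exists_int_solution_of_real {S : Finset (DifferenceEquation ι)} {x : ι → ℝ}
    (hx : ∀ e ∈ S, Satisfies x e) : ∃ p : ι → ℤ, ∀ e ∈ S, Satisfies p e := by
  refine ⟨fun i => ⌊x i⌋, fun e he => ?_⟩
  have hxe : x e.1 = x e.2.1 + e.2.2 := hx e he
  simp only [Satisfies, hxe, Int.floor_add_intCast, Int.cast_id]

theorem exists_forall_le_val_sub [Finite ι] {K m : ℕ} (hm : Nat.card ι * K < m)
    (x : ι → ZMod m) : ∃ t, ∀ i, K ≤ (x i - t).val := by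
  have : NeZero m := ⟨Nat.ne_zero_of_lt hm⟩
  have := Fintype.ofFinite ι
  let close : Finset (ZMod m) := Finset.univ.image fun a : ι × Fin K => x a.1 - (a.2 : ℕ)
  have hclose : close.card < Fintype.card (ZMod m) := by
    rw [ZMod.card]
    refine Finset.card_image_le.trans_lt ?_
    simpa [Nat.card_eq_fintype_card] using hm
  obtain ⟨t, -, ht⟩ := Finset.exists_mem_notMem_of_card_lt_card (t := Finset.univ) hclose
  refine ⟨t, fun i => not_lt.1 fun hi => ht ?_⟩
  exact Finset.mem_image.2 ⟨(i, ⟨_, hi⟩), Finset.mem_univ _, by simp⟩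

theorem exists_int_solution_of_zmod [Finite ι] {S : Finset (DifferenceEquation ι)} {K m : ℕ}
    (hK : ∀ e ∈ S, e.2.2.natAbs ≤ K) (hm : Nat.card ι * K < m) {x : ι → ZMod m}
    (hx : ∀ e ∈ S, Satisfies x e) : ∃ p : ι → ℤ, ∀ e ∈ S, Satisfies p e := by
  have : NeZero m := ⟨Nat.ne_zero_of_lt hm⟩
  -- Read from a point `t` from which no `x i` is reached in fewer than `K` steps, every coordinate
  -- lies in `[K, m)`, so adding a constant of size at most `K` never wraps around.
  obtain ⟨t, ht⟩ := exists_forall_le_val_sub hm x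
  refine ⟨fun i => (x i - t).val, fun e he => ?_⟩
  have hdvd : (m : ℤ) ∣ (x e.1 - t).val - ((x e.2.1 - t).val + e.2.2) := by
    rw [← ZMod.intCast_zmod_eq_zero_iff_dvd]
    have hxe : x e.1 = x e.2.1 + e.2.2 := hx e he
    push_cast [ZMod.natCast_zmod_val]
    rw [hxe]
    ring
  have hi := ht e.1
  have hj := ht e.2.1
  have hi' := (x e.1 - t).val_lt
  have hj' := (x e.2.1 - t).val_lt
  have hc := hK e he
  have := Int.eq_zero_of_abs_lt_dvd hdvd (by rw [abs_lt]; omega)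
  simp only [Satisfies, Int.cast_id]
  omega

end DifferenceEquation

section FiniteFieldMethod

variable {n : ℕ} {S : Finset (DifferenceEquation (Fin n))}

/-- The hyperplane of the real solutions of a difference equation. -/
noncomputable def solutionHyperplane (e : DifferenceEquation (Fin n)) :
    AffineSubspace ℝ (Fin n → ℝ) :=
  differenceHyperplane e.1 e.2.1 e.2.2

theorem solutionHyperplane_ne_top {e : DifferenceEquation (Fin n)} (he : e.1 ≠ e.2.1) :
    solutionHyperplane e ≠ ⊤ := by
  intro htop
  have hmem : Pi.single e.1 ((e.2.2 : ℝ) + 1) ∈ solutionHyperplane e :=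
    htop ▸ AffineSubspace.mem_top _ _ _
  have heq : Pi.single (M := fun _ => ℝ) e.1 ((e.2.2 : ℝ) + 1) e.1 = _ := hmem
  simp [he.symm] at heq

theorem mem_inf_solutionHyperplane_iff {x : Fin n → ℝ} :
    x ∈ S.inf solutionHyperplane ↔ ∀ e ∈ S, Satisfies x e :=
  mem_inf_iff

theorem finrank_direction_inf_solutionHyperplane {p : Fin n → ℤ} (hp : ∀ e ∈ S, Satisfies p e) :
    Module.finrank ℝ (S.inf solutionHyperplane).direction = Nat.card (Quot (Linked S)) := by
  have hp_mem : (fun i => (p i : ℝ)) ∈ S.inf solutionHyperplane :=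
    mem_inf_solutionHyperplane_iff.2 fun e he => (hp e he).intCast
  have hdir : (S.inf solutionHyperplane).direction =
      LinearMap.range (LinearMap.funLeft ℝ ℝ (Quot.mk (Linked S))) := by
    ext v
    rw [← AffineSubspace.vadd_mem_iff_mem_direction v hp_mem, mem_inf_solutionHyperplane_iff,
      forall_satisfies_iff_exists_quot hp, LinearMap.mem_range]
    exact exists_congr fun y => add_left_inj (fun i => (p i : ℝ))
  have := Fintype.ofFinite (Quot (Linked S))
  rw [hdir, LinearMap.finrank_range_of_inj
    (LinearMap.funLeft_injective_of_surjective _ _ _ Quot.mk_surjective),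
    Module.finrank_fintype_fun_eq_card, Nat.card_eq_fintype_card]

open scoped Classical in
theorem eventually_card_solutions_eq (S : Finset (DifferenceEquation (Fin n))) :
    ∀ᶠ m : ℕ in Filter.atTop, Nat.card {x : Fin n → ZMod m // ∀ e ∈ S, Satisfies x e} =
      if ((S.inf solutionHyperplane : AffineSubspace ℝ (Fin n → ℝ)) : Set (Fin n → ℝ)).Nonempty
        then m ^ Module.finrank ℝ (S.inf solutionHyperplane).direction else 0 := by
  filter_upwards [Filter.eventually_gt_atTop
    (Nat.card (Fin n) * S.sup fun e => e.2.2.natAbs)] with m hm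
  split_ifs with hne
  · obtain ⟨x, hx⟩ := hne
    obtain ⟨p, hp⟩ := exists_int_solution_of_real (mem_inf_solutionHyperplane_iff.1 hx)
    rw [card_solutions hp, finrank_direction_inf_solutionHyperplane hp, Nat.card_zmod]
  · have : IsEmpty {x : Fin n → ZMod m // ∀ e ∈ S, Satisfies x e} := by
      refine ⟨fun ⟨x, hx⟩ => hne ?_⟩
      obtain ⟨p, hp⟩ := exists_int_solution_of_zmod
        (fun e he => Finset.le_sup (f := fun e => e.2.2.natAbs) he) hm hx
      exact ⟨fun i => (p i : ℝ), mem_inf_solutionHyperplane_iff.2 fun e he => (hp e he).intCast⟩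
    exact Nat.card_of_isEmpty

open scoped Classical in
theorem card_forall_not_eq_sum_powerset {α κ : Type*} [Finite α] (E : Finset κ)
    (P : α → κ → Prop) :
    (Nat.card {x // ∀ e ∈ E, ¬ P x e} : ℤ) =
      ∑ S ∈ E.powerset, (-1) ^ S.card * (Nat.card {x // ∀ e ∈ S, P x e} : ℤ) := by
  have := Fintype.ofFinite α
  have hcard (Q : α → κ → Prop) (T : Finset κ) :
      Nat.card {x // ∀ e ∈ T, Q x e} = (T.inf fun e => Finset.univ.filter (Q · e)).card := by
    rw [Nat.card_eq_fintype_card, Fintype.card_subtype]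
    congr 1
    ext x
    simp [Finset.mem_inf]
  simp only [hcard, ← Finset.compl_filter]
  exact Finset.inclusion_exclusion_card_inf_compl E _

open scoped Classical in
theorem eventually_eval_charPoly_eq_card (E : Finset (DifferenceEquation (Fin n)))
    (hE : ∀ e ∈ E, e.1 ≠ e.2.1) :
    ∀ᶠ m : ℕ in Filter.atTop, (charPoly (E.image solutionHyperplane)).eval (m : ℤ) =
      Nat.card {x : Fin n → ZMod m // ∀ e ∈ E, ¬ Satisfies x e} := by
  have hcount := (Filter.eventually_all_finset E.powerset).2 fun S _ =>
    eventually_card_solutions_eq S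
  filter_upwards [hcount, Filter.eventually_ne_atTop 0] with m hm hm0
  have : NeZero m := ⟨hm0⟩
  rw [charPoly_image_eq_sum_powerset fun e he => solutionHyperplane_ne_top (hE e he),
    card_forall_not_eq_sum_powerset, Polynomial.eval_finsetSum, Finset.sum_filter]
  refine Finset.sum_congr rfl fun S hS => ?_
  rw [hm S hS]
  split_ifs <;> simp

end FiniteFieldMethod

section Placement

/-- A placement of `d` labels in distinct cells of a row of `L` cells such that label `p` keeps off
the first `min s p` cells and no label `p ≥ s` is followed in the next cell by a larger one. It
encodes the residues `x_1 - x_j` modulo `L + 2` of a point off the arrangement: label `p` stands for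
`j = p + 2`, and cell `c` for the residue `c + 2`, since `0` and `1` are never taken. -/
structure IsPlacement (s : ℕ) {d L : ℕ} (u : Fin d → Fin L) : Prop where
  injective : Function.Injective u
  min_le : ∀ p : Fin d, min s p ≤ (u p : ℕ)
  ne_succ : ∀ p q : Fin d, p < q → s ≤ p → (u q : ℕ) ≠ u p + 1

variable {d L s : ℕ}

theorem isPlacement_cons_succ_iff {v : Fin (L + 1)} {u : Fin d → Fin L} :
    IsPlacement (s + 1) (Fin.cons v (Fin.succ ∘ u) : Fin (d + 1) → Fin (L + 1)) ↔
      IsPlacement s u ∧ v ∉ Set.range (Fin.succ ∘ u) := by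
  constructor
  · rintro ⟨hinj, hmin, hne⟩
    obtain ⟨hv, hu⟩ := Fin.cons_injective_iff.1 hinj
    refine ⟨⟨hu.of_comp, ?_, ?_⟩, hv⟩
    · simpa [Fin.forall_fin_succ, -inf_le_iff, Nat.add_min_add_right] using hmin
    · simpa [Fin.forall_fin_succ] using hne
  · rintro ⟨⟨hinj, hmin, hne⟩, hv⟩
    refine ⟨Fin.cons_injective_iff.2 ⟨hv, (Fin.succ_injective _).comp hinj⟩, ?_, ?_⟩
    · simpa [Fin.forall_fin_succ, -inf_le_iff, Nat.add_min_add_right] using hmin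
    · simpa [Fin.forall_fin_succ] using hne

theorem IsPlacement.exists_eq_cons_succ {w : Fin (d + 1) → Fin (L + 1)}
    (hw : IsPlacement (s + 1) w) : ∃ u : Fin d → Fin L, w = Fin.cons (w 0) (Fin.succ ∘ u) := by
  have hpos (p : Fin d) : w p.succ ≠ 0 := fun h => by
    have := hw.min_le p.succ
    simp [h] at this
  choose u hu using fun p => Fin.exists_succ_eq_of_ne_zero (hpos p)
  exact ⟨u, by rw [← Fin.cons_self_tail w]; congr; exact funext fun p => (hu p).symm⟩

theorem succAbove_val_eq_succ_iff {v : Fin (L + 1)} {a b : Fin L} (hb : Fin.castSucc b ≠ v) :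
    (v.succAbove b : ℕ) = v.succAbove a + 1 ↔ (b : ℕ) = a + 1 := by
  grind [Fin.succAbove]

theorem succAbove_val_eq_self_succ_iff {v : Fin (L + 1)} {b : Fin L} :
    (v.succAbove b : ℕ) = v + 1 ↔ Fin.castSucc b = v := by
  grind [Fin.succAbove]

theorem isPlacement_zero_cons_succAbove_iff {v : Fin (L + 1)} {u : Fin d → Fin L} :
    IsPlacement 0 (Fin.cons v (v.succAbove ∘ u) : Fin (d + 1) → Fin (L + 1)) ↔
      IsPlacement 0 u ∧ v ∉ Set.range (Fin.castSucc ∘ u) := by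
  -- Label `0` is the smallest, so the cell after it is empty; deleting its cell `v` turns that cell
  -- into the one numbered `v`.
  have hlabels : (∀ p q : Fin (d + 1), p < q → 0 ≤ (p : ℕ) →
      ((Fin.cons v (v.succAbove ∘ u) : Fin (d + 1) → Fin (L + 1)) q : ℕ) ≠
        (Fin.cons v (v.succAbove ∘ u) : Fin (d + 1) → Fin (L + 1)) p + 1) ↔
      (∀ q, Fin.castSucc (u q) ≠ v) ∧
        ∀ p q, p < q → (v.succAbove (u q) : ℕ) ≠ v.succAbove (u p) + 1 := by
    simp [Fin.forall_fin_succ, succAbove_val_eq_self_succ_iff]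
  constructor
  · rintro ⟨hinj, -, hne⟩
    obtain ⟨hv, hu⟩ := hlabels.1 hne
    refine ⟨⟨(Fin.cons_injective_iff.1 hinj).2.of_comp, by simp, fun p q hpq _ => ?_⟩, by simpa⟩
    exact (succAbove_val_eq_succ_iff (hv q)).not.1 (hu p q hpq)
  · rintro ⟨⟨hinj, -, hne⟩, hv⟩
    replace hv : ∀ q, Fin.castSucc (u q) ≠ v := by simpa using hv
    refine ⟨Fin.cons_injective_iff.2 ⟨?_, Fin.succAbove_right_injective.comp hinj⟩, by simp,
      hlabels.2 ⟨hv, fun p q hpq => ?_⟩⟩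
    · rintro ⟨p, hp⟩
      exact v.succAbove_ne (u p) hp
    · exact (succAbove_val_eq_succ_iff (hv q)).not.2 (hne p q hpq (Nat.zero_le _))

theorem IsPlacement.exists_eq_cons_succAbove {w : Fin (d + 1) → Fin (L + 1)}
    (hw : IsPlacement s w) :
    ∃ u : Fin d → Fin L, w = Fin.cons (w 0) ((w 0).succAbove ∘ u) := by
  have hne (p : Fin d) : w p.succ ≠ w 0 := hw.injective.ne (Fin.succ_ne_zero p)
  choose u hu using fun p => Fin.exists_succAbove_eq (hne p)
  exact ⟨u, by rw [← Fin.cons_self_tail w]; congr; exact funext fun p => (hu p).symm⟩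

theorem card_eq_card_mul_of_insertion {P : (Fin d → Fin L) → Prop}
    {Q : (Fin (d + 1) → Fin (L + 1)) → Prop} {σ : Fin (L + 1) → Fin L → Fin (L + 1)}
    {τ : Fin L → Fin (L + 1)} (hP : ∀ u, P u → Function.Injective u)
    (hσ : ∀ v, Function.Injective (σ v)) (hτ : Function.Injective τ)
    (hQ : ∀ v u, Q (Fin.cons v (σ v ∘ u)) ↔ P u ∧ v ∉ Set.range (τ ∘ u))
    (hex : ∀ w, Q w → ∃ u, w = Fin.cons (w 0) (σ (w 0) ∘ u)) :
    Nat.card {w // Q w} = Nat.card {u // P u} * (L + 1 - d) := by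
  let insertFirst (a : Σ u : {u // P u}, ((Set.range (τ ∘ u.1))ᶜ : Set (Fin (L + 1)))) :
      {w // Q w} :=
    ⟨Fin.cons a.2.1 (σ a.2.1 ∘ a.1.1), (hQ _ _).2 ⟨a.1.2, a.2.2⟩⟩
  have hinsertFirst : Function.Bijective insertFirst := by
    constructor
    · rintro ⟨⟨u, hu⟩, v, hv⟩ ⟨⟨u', hu'⟩, v', hv'⟩ h
      obtain ⟨rfl, htail⟩ := Fin.cons_injective2 (α := fun _ => Fin (L + 1))
        (congrArg Subtype.val h)
      obtain rfl := (hσ v).comp_left htail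
      rfl
    · rintro ⟨w, hw⟩
      obtain ⟨u, hu⟩ := hex w hw
      obtain ⟨hPu, hv⟩ := (hQ _ _).1 (hu ▸ hw)
      exact ⟨⟨⟨u, hPu⟩, w 0, hv⟩, Subtype.ext hu.symm⟩
  have hcells (u : {u // P u}) :
      Nat.card ((Set.range (τ ∘ u.1))ᶜ : Set (Fin (L + 1))) = L + 1 - d := by
    rw [Nat.card_coe_set_eq, Set.ncard_compl,
      Set.ncard_range_of_injective (hτ.comp (hP u u.2)), Nat.card_fin, Nat.card_fin]
  have := Fintype.ofFinite {u // P u}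
  rw [← Nat.card_eq_of_bijective insertFirst hinsertFirst, Nat.card_sigma]
  simp only [hcells, Finset.sum_const, Finset.card_univ, smul_eq_mul, Nat.card_eq_fintype_card]

theorem card_isPlacement (d s L : ℕ) :
    Nat.card {u : Fin d → Fin L // IsPlacement s u} = (L + 1 - d) ^ d := by
  induction d generalizing s L with
  | zero =>
    have (u : Fin 0 → Fin L) : IsPlacement s u :=
      ⟨Function.injective_of_subsingleton u, fun p => p.elim0, fun p => p.elim0⟩
    simp [this]
  | succ d ih =>
    obtain _ | L := L
    · simp
    rw [pow_succ, Nat.add_sub_add_right]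
    obtain _ | s := s
    · rw [← ih 0 L]
      exact card_eq_card_mul_of_insertion (fun _ hu => hu.injective)
        (fun v => v.succAbove_right_injective) (Fin.castSucc_injective L)
        (fun _ _ => isPlacement_zero_cons_succAbove_iff) fun _ hw => hw.exists_eq_cons_succAbove
    · rw [← ih s L]
      exact card_eq_card_mul_of_insertion (fun _ hu => hu.injective)
        (fun _ => Fin.succ_injective L) (Fin.succ_injective L)
        (fun _ _ => isPlacement_cons_succ_iff) fun _ hw => hw.exists_eq_cons_succ

end Placement

section Between

/-- The difference equations of the hyperplanes of `between n X`. -/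
def betweenEquations (n : ℕ) (X : Finset ℕ) : Finset (DifferenceEquation (Fin n)) :=
  (pairs n).image (fun p => (p.1, p.2, 0)) ∪
    ((pairs n).filter fun p => (p.1 : ℕ) + 1 ∈ X).image (fun p => (p.1, p.2, 1)) ∪
    ((pairs n).filter fun p => (p.1 : ℕ) + 1 ∉ X).image
      (fun p => (⟨0, p.1.pos⟩, p.2, (((p.1 : ℕ) + 1 : ℕ) : ℤ)))

open scoped Classical in
theorem between_eq_image (n : ℕ) (X : Finset ℕ) :
    between n X = (betweenEquations n X).image solutionHyperplane := by
  simp only [between, betweenEquations, cox, Finset.image_union, Finset.image_image]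
  congr 2
  · exact Finset.image_congr fun p _ => by simp [solutionHyperplane, coxHyperplane]
  · exact Finset.image_congr fun p _ => by simp [solutionHyperplane, shiHyperplane]

theorem forall_mem_betweenEquations {n : ℕ} {X : Finset ℕ} {P : DifferenceEquation (Fin n) → Prop} :
    (∀ e ∈ betweenEquations n X, P e) ↔
      (∀ i j : Fin n, i < j → P (i, j, 0)) ∧
      (∀ i j : Fin n, i < j → (i : ℕ) + 1 ∈ X → P (i, j, 1)) ∧
      (∀ i j : Fin n, i < j → (i : ℕ) + 1 ∉ X → P (⟨0, i.pos⟩, j, (((i : ℕ) + 1 : ℕ) : ℤ))) := by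
  simp only [betweenEquations, pairs, Finset.forall_mem_union, Finset.forall_mem_image,
    Finset.mem_filter, Finset.mem_univ, true_and, Prod.forall, and_imp, and_assoc]

theorem ne_of_mem_betweenEquations {n : ℕ} {X : Finset ℕ} :
    ∀ e ∈ betweenEquations n X, e.1 ≠ e.2.1 :=
  forall_mem_betweenEquations.2 ⟨fun _ _ hij => hij.ne, fun _ _ hij _ => hij.ne,
    fun _ _ hij _ => Fin.ne_of_val_ne (Nat.ne_of_lt (Nat.zero_lt_of_lt hij))⟩

section Coordinates

variable {R : Type*} [Ring R] {d : ℕ} {a : R} {v : Fin d → R}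

theorem satisfies_cons_zero_succ_iff {q : Fin d} {c : ℤ} :
    Satisfies (Fin.cons a fun p => a - v p : Fin (d + 1) → R) (0, q.succ, c) ↔ v q = c := by
  simp only [Satisfies, Fin.cons_zero, Fin.cons_succ, sub_add_eq_add_sub, eq_sub_iff_add_eq,
    add_right_inj]

theorem satisfies_cons_succ_succ_iff {p q : Fin d} {c : ℤ} :
    Satisfies (Fin.cons a fun p => a - v p : Fin (d + 1) → R) (p.succ, q.succ, c) ↔
      v q = v p + c := by
  simp only [Satisfies, Fin.cons_succ]
  rw [sub_add, sub_right_inj, eq_sub_iff_add_eq, eq_comm]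

theorem forall_not_satisfies_betweenEquations_iff {s : ℕ} :
    (∀ e ∈ betweenEquations (d + 1) (Finset.Ioo (s + 1) (d + 1)),
        ¬ Satisfies (Fin.cons a fun p => a - v p : Fin (d + 1) → R) e) ↔
      Function.Injective v ∧ (∀ q : Fin d, ∀ c < min s q + 2, v q ≠ (c : ℕ)) ∧
        ∀ p q : Fin d, p < q → s ≤ p → v q ≠ v p + 1 := by
  have hequations : (∀ e ∈ betweenEquations (d + 1) (Finset.Ioo (s + 1) (d + 1)),
      ¬ Satisfies (Fin.cons a fun p => a - v p : Fin (d + 1) → R) e) ↔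
      (∀ q, v q ≠ 0) ∧ (∀ p q, p < q → v q ≠ v p) ∧
      (∀ p q : Fin d, p < q → s ≤ p → (p : ℕ) + 1 < d → v q ≠ v p + 1) ∧
      (∀ q, v q ≠ 1) ∧
      ∀ p q : Fin d, p < q → (s ≤ p → d ≤ p + 1) → v q ≠ (p + 2 : ℕ) := by
    rw [forall_mem_betweenEquations]
    simp [Fin.forall_fin_succ, satisfies_cons_zero_succ_iff, satisfies_cons_succ_succ_iff,
      and_assoc, add_assoc, one_add_one_eq_two]
  rw [hequations]
  constructor
  · rintro ⟨hzero, hne, hshi, hone, hish⟩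
    refine ⟨.of_lt_imp_ne fun p q hpq => (hne p q hpq).symm, ?_,
      fun p q hpq hsp => hshi p q hpq hsp (by omega)⟩
    rintro q (_ | _ | c) hc
    · simpa using hzero q
    · simpa using hone q
    · exact hish ⟨c, by omega⟩ q (Fin.lt_def.2 (by dsimp only; omega)) (by dsimp only; omega)
  · rintro ⟨hinj, hlow, hshi⟩
    exact ⟨fun q => by simpa using hlow q 0 (by omega), fun p q hpq => hinj.ne hpq.ne',
      fun p q hpq hsp _ => hshi p q hpq hsp, fun q => by simpa using hlow q 1 (by omega),
      fun p q hpq hp => hlow q (p + 2) (by omega)⟩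

end Coordinates

theorem natCast_zmod_inj_of_lt_add {m a b : ℕ} (ha : a < b + m) (hb : b < a + m) :
    (a : ZMod m) = b ↔ a = b := by
  rw [ZMod.natCast_eq_natCast_iff]
  exact ⟨fun h => h.eq_of_abs_lt (by rw [abs_lt]; omega), fun h => h ▸ rfl⟩

theorem isPlacement_iff_of_natCast {d s L : ℕ} (hd : d ≤ L) {u : Fin d → Fin L}
    {v : Fin d → ZMod (L + 2)} (hv : ∀ p, v p = (u p + 2 : ℕ)) :
    (Function.Injective v ∧ (∀ q : Fin d, ∀ c < min s q + 2, v q ≠ (c : ℕ)) ∧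
        ∀ p q : Fin d, p < q → s ≤ p → v q ≠ v p + 1) ↔ IsPlacement s u := by
  have heq (p q : Fin d) : v p = v q ↔ u p = u q := by
    rw [hv, hv, natCast_zmod_inj_of_lt_add (by omega) (by omega), add_left_inj, Fin.val_inj]
  have hlow (q : Fin d) : (∀ c < min s q + 2, v q ≠ (c : ℕ)) ↔ min s q ≤ (u q : ℕ) := by
    have hcell (c : ℕ) (hc : c < min s q + 2) : v q = c ↔ (u q : ℕ) + 2 = c := by
      rw [hv, natCast_zmod_inj_of_lt_add (by omega) (by omega)]
    simp only [ne_eq, forall₂_congr fun c hc => not_congr (hcell c hc)]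
    exact ⟨fun h => not_lt.1 fun hlt => h _ (by omega) rfl, fun h c hc => by omega⟩
  have hsucc (p q : Fin d) : v q = v p + 1 ↔ (u q : ℕ) = u p + 1 := by
    rw [hv, hv, ← Nat.cast_add_one, natCast_zmod_inj_of_lt_add (by omega) (by omega)]
    omega
  simp only [Function.Injective, heq, hlow, hsucc, ne_eq]
  exact ⟨fun ⟨h₁, h₂, h₃⟩ => ⟨h₁, h₂, h₃⟩, fun ⟨h₁, h₂, h₃⟩ => ⟨h₁, h₂, h₃⟩⟩

theorem exists_eq_natCast_add_two {L : ℕ} {w : ZMod (L + 2)} (h0 : w ≠ (0 : ℕ))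
    (h1 : w ≠ (1 : ℕ)) : ∃ a : Fin L, w = (a + 2 : ℕ) := by
  have hval (c : ℕ) (hc : w ≠ c) : w.val ≠ c := fun h => hc (h ▸ (ZMod.natCast_zmod_val w).symm)
  have := hval 0 h0
  have := hval 1 h1
  have := w.val_lt
  exact ⟨⟨w.val - 2, by omega⟩, by rw [Nat.sub_add_cancel (by omega), ZMod.natCast_zmod_val]⟩

theorem card_forall_not_satisfies_betweenEquations {d L : ℕ} (s : ℕ) (hd : d ≤ L) :
    Nat.card {x : Fin (d + 1) → ZMod (L + 2) //
        ∀ e ∈ betweenEquations (d + 1) (Finset.Ioo (s + 1) (d + 1)), ¬ Satisfies x e} =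
      (L + 2) * (L + 1 - d) ^ d := by
  rw [← card_isPlacement d s L]
  conv_rhs => rw [← Nat.card_zmod (L + 2)]
  rw [← Nat.card_prod]
  symm
  refine Nat.card_eq_of_bijective (fun y : ZMod (L + 2) × {u : Fin d → Fin L // IsPlacement s u} =>
    ⟨Fin.cons y.1 fun p => y.1 - (y.2.1 p + 2 : ℕ), forall_not_satisfies_betweenEquations_iff.2
      ((isPlacement_iff_of_natCast hd fun _ => rfl).2 y.2.2)⟩) ⟨?_, ?_⟩
  · rintro ⟨a, u, hu⟩ ⟨a', u', hu'⟩ h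
    obtain ⟨rfl, htail⟩ := Fin.cons_injective2 (α := fun _ => ZMod (L + 2))
      (congrArg Subtype.val h)
    refine Prod.ext rfl (Subtype.ext (funext fun p => Fin.ext ?_))
    have hp := sub_right_injective (congrFun htail p)
    rw [natCast_zmod_inj_of_lt_add (by omega) (by omega)] at hp
    exact Nat.add_right_cancel hp
  · rintro ⟨x, hx⟩
    obtain ⟨a, v, rfl⟩ : ∃ a, ∃ v : Fin d → ZMod (L + 2), x = Fin.cons a fun p => a - v p :=
      ⟨x 0, fun p => x 0 - x p.succ, by simp [← Fin.tail_def]⟩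
    have hv := forall_not_satisfies_betweenEquations_iff.1 hx
    choose u hu using fun q =>
      exists_eq_natCast_add_two (hv.2.1 q 0 (by omega)) (hv.2.1 q 1 (by omega))
    exact ⟨⟨a, u, (isPlacement_iff_of_natCast hd hu).1 hv⟩, by simp [← hu]⟩

theorem eq_of_eventually_eval_natCast_eq {R : Type*} [CommRing R] [IsDomain R] [CharZero R]
    {f g : Polynomial R} (h : ∀ᶠ m : ℕ in Filter.atTop, f.eval (m : R) = g.eval (m : R)) :
    f = g :=
  Polynomial.eq_of_infinite_eval_eq f g <|
    ((Nat.frequently_atTop_iff_infinite.1 h.frequently).image Nat.cast_injective.injOn).mono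
      (Set.image_subset_iff.2 fun _ hm => hm)

theorem charPoly_between {k n : ℕ} (hk : k ≠ 0) (hn : n ≠ 0) :
    charPoly (between n (Finset.Ioo k n)) =
      Polynomial.X * (Polynomial.X - Polynomial.C (n : ℤ)) ^ (n - 1) := by
  obtain ⟨s, rfl⟩ := Nat.exists_eq_succ_of_ne_zero hk
  obtain ⟨d, rfl⟩ := Nat.exists_eq_succ_of_ne_zero hn
  refine eq_of_eventually_eval_natCast_eq ?_
  rw [between_eq_image]
  filter_upwards [eventually_eval_charPoly_eq_card _ ne_of_mem_betweenEquations,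
    Filter.eventually_ge_atTop (d + 2)] with m hm hdm
  obtain ⟨L, rfl⟩ := Nat.exists_eq_add_of_le' (Nat.le_of_add_left_le hdm)
  have hd : d ≤ L := Nat.le_of_add_le_add_right hdm
  rw [hm, card_forall_not_satisfies_betweenEquations s hd]
  push_cast [Nat.cast_sub (Nat.le_succ_of_le hd)]
  simp only [Polynomial.eval_mul, Polynomial.eval_pow, Polynomial.eval_sub, Polynomial.eval_X,
    Polynomial.eval_C]
  congr 2
  ring

theorem shi_eq_between (n : ℕ) : shi n = between n (Finset.Ioo 1 n) := by
  classical
  -- `S_{1j}` and `I_{1j}` are the same hyperplane.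
  have hfirst : Set.EqOn (fun p : Fin n × Fin n => ishHyperplane p.1 p.2)
      (fun p => shiHyperplane p.1 p.2)
      ((pairs n).filter fun p => (p.1 : ℕ) + 1 ∉ Finset.Ioo 1 n : Finset (Fin n × Fin n)) := by
    rintro ⟨⟨_ | i, hi⟩, j⟩ hij
    · simp [ishHyperplane, shiHyperplane]
    · simp only [pairs, Finset.coe_filter, Finset.mem_filter_univ, Set.mem_ofPred_eq,
        Finset.mem_Ioo, Fin.lt_def] at hij
      omega
  rw [shi, between, Finset.image_congr hfirst, Finset.union_assoc, ← Finset.image_union,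
    Finset.filter_union_filter_not_eq]

theorem ish_eq_between (n : ℕ) : ish n = between n (Finset.Ioo n n) := by
  simp [ish, between]

end Between

end HyperplaneArrangement

theorem theorem2p2 (k n : ℕ) (hk : 1 ≤ k) (hkn : k < n) :
    HyperplaneArrangement.charPoly (HyperplaneArrangement.between n (Finset.Ioo k n)) =
        Polynomial.X * (Polynomial.X - Polynomial.C (n : ℤ)) ^ (n - 1) ∧
      HyperplaneArrangement.charPoly (HyperplaneArrangement.between n (Finset.Ioo k n)) =
        HyperplaneArrangement.charPoly (HyperplaneArrangement.shi n) ∧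
      HyperplaneArrangement.charPoly (HyperplaneArrangement.between n (Finset.Ioo k n)) =
        HyperplaneArrangement.charPoly (HyperplaneArrangement.ish n) := by
  obtain ⟨hk0, hn0⟩ : k ≠ 0 ∧ n ≠ 0 := by omega
  rw [HyperplaneArrangement.shi_eq_between, HyperplaneArrangement.ish_eq_between,
    HyperplaneArrangement.charPoly_between hk0 hn0,
    HyperplaneArrangement.charPoly_between one_ne_zero hn0,
    HyperplaneArrangement.charPoly_between hn0 hn0]
  exact ⟨rfl, rfl, rfl⟩
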